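/- Let the Zimin patterns be $Z_1=x_1$ and $Z_{k}=Z_{k-1}\,x_k\,Z_{k-1}$ for $k>1$ (so $k$ is the rank of $Z_k$). A pattern $X$ embeds in a word $w$ if $w$ has a factor (contiguous subword) of the form $h(X)$ for a non-erasing morphism $h$. Let $F_{-1}=b$, $F_0=a$, $F_j=F_{j-1}F_{j-2}$ for $j\ge 1$ be the Fibonacci words, let $F_\infty$ be the infinite word that has all $F_j$, $j\ge 0$, as prefixes, and let $F_\infty[1..n]$ be its prefix of length $n$. Consider a machine with finitely many registers for natural numbers whose instructions are: loading a constant, copying a register, adding two registers, a jump conditioned on the comparison ($\le$) of two registers, appending the number in a register to the output, and halting. Each instruction takes one unit of time; on input $n$, only constants up to $n$ may be loaded and only numbers up to $n$ may be added (so every number that occurs, in particular every number compared, is up to $n$ or is a sum of two numbers up to $n$). Theorem. There is a single program for this machine which, on every input $n\ge 1$, halts after $T(n)$ steps, where $T(n)=O(\log n)$, and outputs the maximal rank $k\ge 1$ of a Zimin pattern that embeds in $F_\infty[1..n]$, followed by a description of a non-erasing morphism $h$ such that $h(Z_k)$ is a factor of $F_\infty[1..n]$. This morphism sends $x_1\mapsto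 F_0=a$ and $x_i\mapsto F_{2i-5}$ for $2\le i\le k$ (so $x_2\mapsto F_{-1}=b$, $x_3\mapsto F_1$, …, $x_k\mapsto F_{2k-5}$), and it is described by a list of $k$ numbers, the $i$-th of which is $c$ if $h(x_i)=F_{c-1}$. -/

import Mathlib

/-! Words, patterns and embeddings -/

/-- `EmbedsVia h X w`: the morphism given on variables by `h` is non-erasing and the image of the
pattern `X` under it is a factor (a contiguous subword) of the word `w`. -/
def EmbedsVia {V α : Type} (h : V → List α) (X : List V) (w : List α) : Prop :=
  (∀ x, h x ≠ []) ∧ X.flatMap h <:+: w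

/-- The pattern `X` embeds in the word `w`. -/
def Embeds {V α : Type} (X : List V) (w : List α) : Prop :=
  ∃ h : V → List α, EmbedsVia h X w

/-- The Zimin pattern `Z_k`; the variable `x_i` is represented by the number `i`.
`Z_1 = x_1` and `Z_{k+1} = Z_k x_{k+1} Z_k` (with the empty word as `Z_0`). -/
def zimin : ℕ → List ℕ
  | 0 => []
  | k + 1 => zimin k ++ [k + 1] ++ zimin k

/-! Fibonacci words -/

/-- The binary alphabet of the Fibonacci words. -/
inductive Letter : Type
  | a : Letter
  | b : Letter

/-- Fibonacci words with the index shifted by one: `fibWordAux m` is `F_{m-1}`. -/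
def fibWordAux : ℕ → List Letter
  | 0 => [Letter.b]
  | 1 => [Letter.a]
  | m + 2 => fibWordAux (m + 1) ++ fibWordAux m

/-- The Fibonacci word `F_j` for an integer `j ≥ -1`:
`F_{-1} = b`, `F_0 = a`, `F_j = F_{j-1} F_{j-2}`. Only used for `j ≥ -1`. -/
def fibWord (j : ℤ) : List Letter := fibWordAux (j + 1).toNat

theorem fibWord_neg_one : fibWord (-1) = [Letter.b] := rfl

theorem fibWord_zero : fibWord 0 = [Letter.a] := rfl

theorem fibWord_rec (j : ℤ) (hj : 1 ≤ j) : fibWord j = fibWord (j - 1) ++ fibWord (j - 2) := by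
  obtain ⟨m, rfl⟩ : ∃ m : ℕ, j = (m : ℤ) + 1 := ⟨(j - 1).toNat, by omega⟩
  have h1 : ((m : ℤ) + 1 + 1).toNat = m + 2 := by omega
  have h2 : ((m : ℤ) + 1 - 1 + 1).toNat = m + 1 := by omega
  have h3 : ((m : ℤ) + 1 - 2 + 1).toNat = m := by omega
  simp only [fibWord, h1, h2, h3, fibWordAux]

/-- The infinite Fibonacci word `F_∞`, its letters being numbered from `0`: the `i`-th letter is
read off from the Fibonacci word `F_{i+1}`, whose length exceeds `i`. -/
def fibInf (i : ℕ) : Letter := (fibWordAux (i + 2)).getD i Letter.a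

/-- The prefix `F_∞[1..n]` of length `n` of the infinite Fibonacci word. -/
def fibPrefix (n : ℕ) : List Letter := (List.range n).map fibInf

theorem lt_length_fibWordAux (i : ℕ) : i < (fibWordAux (i + 2)).length := by
  have key : ∀ m, 0 < (fibWordAux m).length ∧ m < (fibWordAux (m + 2)).length := by
    intro m
    induction m using Nat.strong_induction_on with
    | _ m ih =>
      match m with
      | 0 => simp [fibWordAux]
      | 1 => simp [fibWordAux]
      | m + 2 =>
        have h1 := ih (m + 1) (by omega)
        have h0 := ih m (by omega)
        simp only [fibWordAux, List.length_append] at *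
        omega
  exact (key i).2

theorem fibWordAux_prefix {m p : ℕ} (h : m ≤ p) : fibWordAux (m + 1) <+: fibWordAux (p + 1) := by
  induction p, h using Nat.le_induction with
  | base => exact List.prefix_rfl
  | succ p _ ih => exact ih.trans (List.prefix_append _ _)

/-- `F_∞` has every `F_m` with `m ≥ 0` as a prefix. -/
theorem fibPrefix_length_fibWord (m : ℕ) :
    fibPrefix (fibWord m).length = fibWord m := by
  have hm : ((m : ℤ) + 1).toNat = m + 1 := by omega
  simp only [fibWord, hm]
  apply List.ext_getElem
  · simp [fibPrefix]
  · intro i h1 h2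
    simp only [fibPrefix, List.getElem_map, List.getElem_range, fibInf]
    rw [List.getD_eq_getElem _ _ (lt_length_fibWordAux i)]
    rcases le_total m (i + 1) with h | h
    · exact ((fibWordAux_prefix h).getElem h2).symm
    · exact (fibWordAux_prefix h).getElem (lt_length_fibWordAux i)

/-! A machine whose arithmetic consists of addition and comparison of bounded numbers -/

/-- Instructions. Registers are numbered by natural numbers and hold natural numbers; a program
mentions only finitely many of them. -/
inductive Instr : Type
  /-- `const d c`: put the constant `c` into register `d` -/
  | const (d c : ℕ) : Instr
  /-- `copy d s`: copy register `s` to register `d` -/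
  | copy (d s : ℕ) : Instr
  /-- `add d s t`: put the sum of registers `s` and `t` into register `d` -/
  | add (d s t : ℕ) : Instr
  /-- `jle s t l`: continue at instruction `l` if the number in register `s` is at most the one in
  register `t`, and at the next instruction otherwise -/
  | jle (s t l : ℕ) : Instr
  /-- `write s`: append the number in register `s` to the output -/
  | write (s : ℕ) : Instr
  /-- stop -/
  | halt : Instr

/-- A program is a finite list of instructions, numbered from `0`. -/
abbrev Program : Type := List Instr

/-- A configuration: program counter, contents of the registers, output written so far. -/
structure Config : Type where
  pc : ℕ
  reg : ℕ → ℕ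
  out : List ℕ

/-- One step of the machine for numbers up to `N`; each instruction takes one unit of time. Only
numbers up to `N` can be added, and only constants up to `N` can be loaded: there is no next
configuration otherwise. So, on an input up to `N`, all numbers that ever occur (in particular
those that are compared) are either up to `N` or the sum of two numbers up to `N`. There is no next
configuration at `halt` or outside the program either. -/
def machineStep (N : ℕ) (P : Program) (c : Config) : Option Config :=
  match P[c.pc]? with
  | some (.const d v) =>
      if v ≤ N then some ⟨c.pc + 1, Function.update c.reg d v, c.out⟩ else none
  | some (.copy d s) => some ⟨c.pc + 1, Function.update c.reg d (c.reg s), c.out⟩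
  | some (.add d s t) =>
      if c.reg s ≤ N ∧ c.reg t ≤ N then
        some ⟨c.pc + 1, Function.update c.reg d (c.reg s + c.reg t), c.out⟩
      else none
  | some (.jle s t l) => some ⟨if c.reg s ≤ c.reg t then l else c.pc + 1, c.reg, c.out⟩
  | some (.write s) => some ⟨c.pc + 1, c.reg, c.out ++ [c.reg s]⟩
  | some .halt => none
  | none => none

/-- The configuration after exactly `t` steps, if the machine makes that many. -/
def machineRun (N : ℕ) (P : Program) : ℕ → Config → Option Config
  | 0, c => some c
  | t + 1, c => (machineStep N P c).bind (machineRun N P t)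

/-- The start on input `n`: register `0` holds `n`, all other registers hold `0`. -/
def initConfig (n : ℕ) : Config := ⟨0, fun r => if r = 0 then n else 0, []⟩

/-- On input `n`, using arithmetic on numbers up to `n` only, the program `P` reaches a `halt`
instruction after exactly `t` steps, with output `o`. -/
def ComputesInTime (P : Program) (n t : ℕ) (o : List ℕ) : Prop :=
  ∃ c, machineRun n P t (initConfig n) = some c ∧ P[c.pc]? = some Instr.halt ∧ c.out = o

/-- The list `code` describes the morphism `h` on the variables `x_1, …, x_k`: it has `k` entries,
and if the entry for `x_i` is `c`, then `h` sends `x_i` to the Fibonacci word `F_{c-1}`. -/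
def DescribesMorphism (code : List ℕ) (k : ℕ) (h : ℕ → List Letter) : Prop :=
  code.length = k ∧
    ∀ (i : ℕ) (hi : i < code.length), h (i + 1) = fibWord ((code[i] : ℤ) - 1)

/-! Rational approximation of the inverse of the golden ratio -/

open Real in
theorem fib_succ_mul_neg_goldenConj (m : ℕ) :
    (Nat.fib (m + 1) : ℝ) * (-goldenConj) = Nat.fib m - goldenConj ^ (m + 1) := by
  have h := fib_succ_sub_goldenRatio_mul_fib m
  have h2 := goldenRatio_mul_goldenConj
  rw [pow_succ, ← h]
  linear_combination (-(Nat.fib m : ℝ)) * h2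

theorem exists_fib_coordinates (m : ℕ) (t p : ℤ) :
    ∃ u v : ℤ, t = u * Nat.fib (m + 1) + v * Nat.fib (m + 2) ∧
      p = u * Nat.fib m + v * Nat.fib (m + 1) := by
  induction m with
  | zero => exact ⟨t - p, p, by simp, by simp⟩
  | succ m ih =>
    obtain ⟨u, v, h1, h2⟩ := ih
    refine ⟨v - u, u, ?_, ?_⟩
    · rw [h1, Nat.fib_add_two (n := m + 1)]; push_cast; ring
    · rw [h2, Nat.fib_add_two (n := m)]; push_cast; ring

open Real in
/-- Multiples of the inverse golden ratio by `0 < t < fib (m + 2)` keep their distance from the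
integers. -/
theorem goldenConj_best_approximation (m : ℕ) (t p : ℤ) (h0 : 0 < t) (ht : t < Nat.fib (m + 2)) :
    |goldenConj| ^ (m + 1) ≤ |(t : ℝ) * (-goldenConj) - p| := by
  obtain ⟨u, v, h1, h2⟩ := exists_fib_coordinates m t p
  have hA : (0 : ℤ) < Nat.fib (m + 1) := by exact_mod_cast Nat.fib_pos.2 (by omega)
  have hB : (0 : ℤ) < Nat.fib (m + 2) := by exact_mod_cast Nat.fib_pos.2 (by omega)
  have e : (t : ℝ) * (-goldenConj) - p = -goldenConj ^ (m + 1) * (u + v * goldenConj) := by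
    have e1 := fib_succ_mul_neg_goldenConj m
    have e2 := fib_succ_mul_neg_goldenConj (m + 1)
    rw [h1, h2]
    push_cast
    linear_combination (u : ℝ) * e1 + (v : ℝ) * e2
  rw [e, abs_mul, abs_neg, abs_pow]
  have hc := goldenConj_neg
  refine le_mul_of_one_le_right (by positivity) ?_
  have key : (1 ≤ u ∧ v ≤ 0) ∨ (u ≤ -1 ∧ 0 ≤ v) := by
    rcases lt_trichotomy u 0 with hu | hu | hu
    · right
      refine ⟨by omega, ?_⟩
      by_contra! hv
      nlinarith
    · exfalso
      subst hu
      have : 0 < v := by by_contra! hv; nlinarith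
      nlinarith
    · left
      refine ⟨by omega, ?_⟩
      by_contra! hv
      nlinarith
  rcases key with ⟨hu, hv⟩ | ⟨hu, hv⟩
  · have hu' : (1 : ℝ) ≤ u := by exact_mod_cast hu
    have hv' : (v : ℝ) ≤ 0 := by exact_mod_cast hv
    refine le_trans ?_ (le_abs_self _)
    nlinarith
  · have hu' : (u : ℝ) ≤ -1 := by exact_mod_cast hu
    have hv' : (0 : ℝ) ≤ v := by exact_mod_cast hv
    refine le_trans ?_ (neg_le_abs _)
    nlinarith

/-! Counting letters in prefixes of the infinite Fibonacci word -/

/-- The indicator of the letter `a`. -/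
def Letter.isA : Letter → ℤ
  | .a => 1
  | .b => 0

/-- The number of letters `a` among the first `i` letters of `F_∞`. -/
def fibCount (i : ℕ) : ℤ := ∑ j ∈ Finset.range i, (fibInf j).isA

theorem fibCount_succ (i : ℕ) : fibCount (i + 1) = fibCount i + (fibInf i).isA :=
  Finset.sum_range_succ _ _

theorem length_fibWordAux : ∀ m : ℕ, (fibWordAux m).length = Nat.fib (m + 1)
  | 0 => rfl
  | 1 => rfl
  | m + 2 => by
    rw [fibWordAux, List.length_append, length_fibWordAux (m + 1), length_fibWordAux m,
      Nat.fib_add_two (n := m + 1), add_comm]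

theorem getElem_fibWordAux_succ (m i : ℕ) (hi : i < (fibWordAux (m + 1)).length) :
    (fibWordAux (m + 1))[i] = fibInf i := by
  rw [fibInf, List.getD_eq_getElem _ _ (lt_length_fibWordAux i)]
  rcases le_total m (i + 1) with h | h
  · exact (fibWordAux_prefix h).getElem hi
  · exact ((fibWordAux_prefix h).getElem (lt_length_fibWordAux i)).symm

theorem fibInf_fib_add (m j : ℕ) (hj : j < Nat.fib (m + 2)) :
    fibInf (Nat.fib (m + 3) + j) = fibInf j := by
  have hl : (fibWordAux (m + 2)).length = Nat.fib (m + 3) := length_fibWordAux _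
  have hl' : (fibWordAux (m + 1)).length = Nat.fib (m + 2) := length_fibWordAux _
  have hi : Nat.fib (m + 3) + j < (fibWordAux (m + 2) ++ fibWordAux (m + 1)).length := by
    rw [List.length_append]; omega
  have h1 : (fibWordAux (m + 2) ++ fibWordAux (m + 1))[Nat.fib (m + 3) + j] =
      fibInf (Nat.fib (m + 3) + j) := getElem_fibWordAux_succ (m + 2) _ hi
  rw [List.getElem_append_right (by omega)] at h1
  rw [← h1, ← getElem_fibWordAux_succ m j (by omega)]
  congr 1
  omega

theorem fibCount_add_of_le (m j : ℕ) (hj : j ≤ Nat.fib (m + 2)) :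
    fibCount (Nat.fib (m + 3) + j) = fibCount (Nat.fib (m + 3)) + fibCount j := by
  induction j with
  | zero => simp [fibCount]
  | succ j ih =>
    rw [← add_assoc, fibCount_succ, ih (by omega), fibInf_fib_add m j (by omega), fibCount_succ,
      add_assoc]

theorem fibCount_fib (m : ℕ) :
    fibCount (Nat.fib (m + 2)) = Nat.fib (m + 1) ∧
      fibCount (Nat.fib (m + 3)) = Nat.fib (m + 2) := by
  induction m with
  | zero =>
    have h2 : Nat.fib 3 = 2 := rfl
    constructor <;>
      simp [h2, fibCount, Finset.sum_range_succ, fibInf, fibWordAux, Letter.isA]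
  | succ m ih =>
    refine ⟨ih.2, ?_⟩
    rw [Nat.fib_add_two (n := m + 2), add_comm (Nat.fib (m + 2)), fibCount_add_of_le m _ le_rfl,
      ih.1, ih.2, Nat.fib_add_two (n := m + 1)]
    push_cast
    ring

open Real in
theorem abs_goldenConj_lt_one : |goldenConj| < 1 := by
  rw [abs_lt]
  exact ⟨neg_one_lt_goldenConj, goldenConj_neg.trans one_pos⟩

open Real in
theorem fibCount_eq_floor (i : ℕ) : fibCount i = ⌊((i : ℝ) + 1) * (-goldenConj)⌋ := by
  have hn := goldenConj_neg
  have h1 := neg_one_lt_goldenConj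
  have hsq := goldenConj_sq
  induction i using Nat.strong_induction_on with
  | _ i ih =>
    symm
    rcases lt_or_ge i 2 with hi | hi
    · have : i = 0 ∨ i = 1 := by omega
      rcases this with rfl | rfl
      · rw [Int.floor_eq_iff]
        simp [fibCount]
        constructor <;> linarith
      · rw [Int.floor_eq_iff]
        simp [fibCount, fibInf, fibWordAux, Letter.isA]
        constructor <;> nlinarith
    · obtain ⟨m, hm1, hm2⟩ : ∃ m, Nat.fib (m + 3) ≤ i ∧ i < Nat.fib (m + 4) := by
        have hex : ∃ m, i < Nat.fib (m + 4) :=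
          ⟨i + 1, lt_of_lt_of_le (by omega) (Nat.le_fib_self (by omega : 5 ≤ i + 1 + 4))⟩
        classical
        refine ⟨Nat.find hex, ?_, Nat.find_spec hex⟩
        rcases hq : Nat.find hex with _ | q
        · exact hi
        · have := Nat.find_min hex (m := q) (by omega)
          exact not_lt.1 this
      obtain ⟨j, rfl⟩ := Nat.exists_eq_add_of_le hm1
      have hj : j < Nat.fib (m + 2) := by
        have : Nat.fib (m + 4) = Nat.fib (m + 2) + Nat.fib (m + 3) := Nat.fib_add_two
        omega
      have hpos : 0 < Nat.fib (m + 3) := Nat.fib_pos.2 (by omega)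
      rw [fibCount_add_of_le m j hj.le, (fibCount_fib m).2, ih j (by omega)]
      have e := fib_succ_mul_neg_goldenConj (m + 2)
      have hlt : ((j : ℤ) + 1) < Nat.fib (m + 3) := by
        have : Nat.fib (m + 3) = Nat.fib (m + 1) + Nat.fib (m + 2) := Nat.fib_add_two
        have : 0 < Nat.fib (m + 1) := Nat.fib_pos.2 (by omega)
        omega
      have hb := fun p : ℤ =>
        goldenConj_best_approximation (m + 1) ((j : ℤ) + 1) p (by omega) hlt
      have hsmall : |goldenConj ^ (m + 2 + 1)| < |goldenConj| ^ (m + 1 + 1) := by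
        rw [abs_pow, pow_succ]
        exact mul_lt_of_lt_one_right (pow_pos (abs_pos.2 hn.ne) _) abs_goldenConj_lt_one
      set P := ⌊((j : ℝ) + 1) * (-goldenConj)⌋ with hP
      have hP1 : (P : ℝ) ≤ ((j : ℝ) + 1) * (-goldenConj) := Int.floor_le _
      have hP2 : ((j : ℝ) + 1) * (-goldenConj) < P + 1 := Int.lt_floor_add_one _
      have b1 := hb P
      have b2 := hb (P + 1)
      push_cast at b1 b2
      rw [abs_of_nonneg (sub_nonneg.2 hP1)] at b1
      rw [abs_of_nonpos (sub_nonpos.2 hP2.le)] at b2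
      have s := abs_lt.1 hsmall
      rw [Int.floor_eq_iff]
      push_cast
      constructor <;> nlinarith [s.1, s.2]

/-! Repetitions in the infinite Fibonacci word -/

open Real in
/-- Two windows of length `fib (2 p + 2)` with an exceptional number of letters `a` are at least
`fib (2 p + 3)` apart. -/
theorem fibCount_window (p : ℕ) :
    (∀ y, fibCount (y + Nat.fib (2 * p + 2)) - fibCount y = Nat.fib (2 * p + 1) ∨
      fibCount (y + Nat.fib (2 * p + 2)) - fibCount y = Nat.fib (2 * p + 1) - 1) ∧
    ∀ y y', y < y' → y' < y + Nat.fib (2 * p + 3) →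
      fibCount (y + Nat.fib (2 * p + 2)) - fibCount y = Nat.fib (2 * p + 1) - 1 →
      fibCount (y' + Nat.fib (2 * p + 2)) - fibCount y' ≠ Nat.fib (2 * p + 1) - 1 := by
  have e := fib_succ_mul_neg_goldenConj (2 * p + 1)
  have hd : goldenConj ^ (2 * p + 1 + 1) = |goldenConj| ^ (2 * p + 1 + 1) := by
    rw [← abs_pow, abs_of_nonneg (Even.pow_nonneg ⟨p + 1, by ring⟩ _)]
  have hd0 : 0 < |goldenConj| ^ (2 * p + 1 + 1) := pow_pos (abs_pos.2 goldenConj_neg.ne) _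
  have hd1 : |goldenConj| ^ (2 * p + 1 + 1) < 1 :=
    pow_lt_one₀ (abs_nonneg _) abs_goldenConj_lt_one (by omega)
  rw [hd] at e
  have hfl : ∀ y : ℕ, fibCount (y + Nat.fib (2 * p + 2)) =
      Nat.fib (2 * p + 1) + ⌊((y : ℝ) + 1) * (-goldenConj) - |goldenConj| ^ (2 * p + 1 + 1)⌋ := by
    intro y
    rw [fibCount_eq_floor, ← Int.floor_natCast_add]
    congr 1
    push_cast
    linear_combination e
  have hlow : ∀ y : ℕ, fibCount (y + Nat.fib (2 * p + 2)) - fibCount y = Nat.fib (2 * p + 1) - 1 →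
      (fibCount y : ℝ) ≤ ((y : ℝ) + 1) * (-goldenConj) ∧
        ((y : ℝ) + 1) * (-goldenConj) < fibCount y + |goldenConj| ^ (2 * p + 1 + 1) := by
    intro y hy
    rw [hfl y] at hy
    have h1 : ⌊((y : ℝ) + 1) * (-goldenConj) - |goldenConj| ^ (2 * p + 1 + 1)⌋ =
      fibCount y - 1 := by omega
    have h2 := Int.lt_floor_add_one
      (((y : ℝ) + 1) * (-goldenConj) - |goldenConj| ^ (2 * p + 1 + 1))
    rw [h1] at h2
    push_cast at h2
    refine ⟨?_, by linarith⟩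
    rw [fibCount_eq_floor]
    exact Int.floor_le _
  refine ⟨fun y => ?_, fun y y' hy hy' h h' => ?_⟩
  · rw [hfl y]
    have h1 := Int.floor_le (((y : ℝ) + 1) * (-goldenConj))
    have h2 := Int.lt_floor_add_one (((y : ℝ) + 1) * (-goldenConj))
    rw [← fibCount_eq_floor] at h1 h2
    have h3 : ⌊((y : ℝ) + 1) * (-goldenConj) - |goldenConj| ^ (2 * p + 1 + 1)⌋ <
        fibCount y + 1 := by
      rw [Int.floor_lt]; push_cast; linarith
    have h4 : fibCount y - 1 ≤
        ⌊((y : ℝ) + 1) * (-goldenConj) - |goldenConj| ^ (2 * p + 1 + 1)⌋ := by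
      rw [Int.le_floor]; push_cast; linarith
    omega
  · have a1 := hlow y h
    have a2 := hlow y' h'
    have hb := goldenConj_best_approximation (2 * p + 1) ((y' : ℤ) - y) (fibCount y' - fibCount y)
      (by omega) (by
        have h3 : Nat.fib (2 * p + 1 + 2) = Nat.fib (2 * p + 3) := rfl
        omega)
    refine absurd hb (not_le.2 ?_)
    push_cast
    rw [abs_lt]
    constructor <;> nlinarith [a1.1, a1.2, a2.1, a2.2]

theorem sum_fibCount_window (p x d : ℕ) (hd : d ≤ Nat.fib (2 * p + 3)) :
    (∑ t ∈ Finset.range d, (fibCount (x + t + Nat.fib (2 * p + 2)) - fibCount (x + t))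
      = d * Nat.fib (2 * p + 1)) ∨
    (∑ t ∈ Finset.range d, (fibCount (x + t + Nat.fib (2 * p + 2)) - fibCount (x + t))
      = d * Nat.fib (2 * p + 1) - 1) := by
  obtain ⟨h1, h2⟩ := fibCount_window p
  by_cases hex : ∃ t < d, fibCount (x + t + Nat.fib (2 * p + 2)) - fibCount (x + t) =
      Nat.fib (2 * p + 1) - 1
  · right
    obtain ⟨t, ht, hs⟩ := hex
    have : ∀ s ∈ Finset.range d, fibCount (x + s + Nat.fib (2 * p + 2)) - fibCount (x + s) =
        Nat.fib (2 * p + 1) + if s = t then -1 else 0 := by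
      intro s hsd
      rw [Finset.mem_range] at hsd
      split_ifs with hst
      · rw [hst, hs]; rfl
      · rw [add_zero]
        refine (h1 (x + s)).resolve_right fun h => ?_
        rcases lt_or_gt_of_ne hst with hlt | hlt
        · exact h2 (x + s) (x + t) (by omega) (by omega) h hs
        · exact h2 (x + t) (x + s) (by omega) (by omega) hs h
    rw [Finset.sum_congr rfl this, Finset.sum_add_distrib]
    rw [Finset.sum_ite_eq', if_pos (Finset.mem_range.2 ht), Finset.sum_const, Finset.card_range,
      nsmul_eq_mul]
    ring
  · left
    push Not at hex
    rw [Finset.sum_congr rfl fun s hs =>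
      (h1 (x + s)).resolve_right (hex s (Finset.mem_range.1 hs))]
    simp

theorem sum_range_shift_comm (f : ℕ → ℤ) (L d : ℕ) :
    ∑ j ∈ Finset.range L, (f (j + d) - f j) = ∑ t ∈ Finset.range d, (f (t + L) - f t) := by
  have h1 := Finset.sum_range_add f L d
  have h2 := Finset.sum_range_add f d L
  rw [add_comm d L] at h2
  have h3 : ∑ j ∈ Finset.range L, f (j + d) = ∑ j ∈ Finset.range L, f (d + j) :=
    Finset.sum_congr rfl fun j _ => by rw [add_comm]
  have h4 : ∑ t ∈ Finset.range d, f (t + L) = ∑ t ∈ Finset.range d, f (L + t) :=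
    Finset.sum_congr rfl fun t _ => by rw [add_comm]
  rw [Finset.sum_sub_distrib, Finset.sum_sub_distrib]
  linarith

theorem fib_cassini (p : ℕ) :
    (Nat.fib (2 * p + 1) : ℤ) * Nat.fib (2 * p + 1) =
      Nat.fib (2 * p + 2) * Nat.fib (2 * p) + 1 := by
  induction p with
  | zero => simp
  | succ p ih =>
    have a1 : Nat.fib (2 * (p + 1)) = Nat.fib (2 * p) + Nat.fib (2 * p + 1) := Nat.fib_add_two
    have a2 : Nat.fib (2 * (p + 1) + 1) = Nat.fib (2 * p + 1) + Nat.fib (2 * (p + 1)) :=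
      Nat.fib_add_two
    have a3 : Nat.fib (2 * (p + 1) + 2) = Nat.fib (2 * (p + 1)) + Nat.fib (2 * (p + 1) + 1) :=
      Nat.fib_add_two
    have a4 : Nat.fib (2 * p + 2) = Nat.fib (2 * p) + Nat.fib (2 * p + 1) := Nat.fib_add_two
    rw [a4] at ih
    rw [a3, a2, a1]
    push_cast at ih ⊢
    linear_combination ih

/-- A factor of `F_∞` of length `fib (2 p + 2)` does not recur at a distance strictly between
`fib (2 p + 2)` and `fib (2 p + 3)`. -/
theorem no_repetition_fibInf (p i d : ℕ) (h1 : Nat.fib (2 * p + 2) < d)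
    (h2 : d < Nat.fib (2 * p + 3))
    (h : ∀ j < Nat.fib (2 * p + 2), fibInf (i + j) = fibInf (i + d + j)) : False := by
  have hc : ∀ j ≤ Nat.fib (2 * p + 2),
      fibCount (i + (j + d)) - fibCount (i + j) = fibCount (i + d) - fibCount i := by
    intro j hj
    induction j with
    | zero => simp
    | succ j ih =>
      have e1 : i + (j + 1 + d) = i + (j + d) + 1 := by ring
      have e2 : i + d + j = i + (j + d) := by ring
      have := h j (by omega)
      rw [e1, ← add_assoc i j 1, fibCount_succ, fibCount_succ, this, e2, ← ih (by omega)]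
      ring
  have hsum := sum_range_shift_comm (fun y => fibCount (i + y)) (Nat.fib (2 * p + 2)) d
  rw [Finset.sum_congr rfl fun j hj => hc j (Finset.mem_range.1 hj).le] at hsum
  simp only [Finset.sum_const, Finset.card_range, nsmul_eq_mul, ← add_assoc] at hsum
  have hcas := fib_cassini p
  have hfib : Nat.fib (2 * p + 3) = Nat.fib (2 * p + 1) + Nat.fib (2 * p + 2) := Nat.fib_add_two
  have hmono : Nat.fib (2 * p + 1) ≤ Nat.fib (2 * p + 2) := Nat.fib_mono (by omega)
  rcases sum_fibCount_window p i d h2.le with hw | hw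
  · rw [hw] at hsum
    have hdvd : (Nat.fib (2 * p + 2) : ℤ) ∣ (d : ℤ) - Nat.fib (2 * p + 2) :=
      ⟨(fibCount (i + d) - fibCount i) * Nat.fib (2 * p + 1) - d * Nat.fib (2 * p) - 1, by
        linear_combination (Nat.fib (2 * p + 1) : ℤ) * (-hsum) - (d : ℤ) * hcas⟩
    have := Int.le_of_dvd (by omega) hdvd
    omega
  · rw [hw] at hsum
    have hdvd : (Nat.fib (2 * p + 2) : ℤ) ∣ (d : ℤ) - Nat.fib (2 * p + 1) :=
      ⟨(fibCount (i + d) - fibCount i) * Nat.fib (2 * p + 1) - d * Nat.fib (2 * p), by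
        linear_combination (Nat.fib (2 * p + 1) : ℤ) * (-hsum) - (d : ℤ) * hcas⟩
    have := Int.le_of_dvd (by omega) hdvd
    omega

/-! Zimin patterns in the Fibonacci words -/

theorem fib_le_length_zimin (h : ℕ → List Letter) (hne : ∀ x, h x ≠ []) (r i : ℕ)
    (hocc : ∀ j < ((zimin (r + 1)).flatMap h).length,
      ((zimin (r + 1)).flatMap h)[j]? = some (fibInf (i + j))) :
    Nat.fib (2 * r + 2) ≤ ((zimin (r + 1)).flatMap h).length := by
  induction r generalizing i with
  | zero =>
    have := List.length_pos_of_ne_nil (hne 1)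
    simp [zimin]
    omega
  | succ r ih =>
    set u := (zimin (r + 1)).flatMap h with hu
    have hw : (zimin (r + 1 + 1)).flatMap h = u ++ (h (r + 2) ++ u) := by
      rw [zimin, List.flatMap_append, List.flatMap_append, ← hu]
      simp
    rw [hw] at hocc ⊢
    have hv := List.length_pos_of_ne_nil (hne (r + 2))
    simp only [List.length_append] at hocc ⊢
    have o1 : ∀ j < u.length, u[j]? = some (fibInf (i + j)) := by
      intro j hj
      rw [← hocc j (by omega), List.getElem?_append_left hj]
    have o2 : ∀ j < u.length, u[j]? = some (fibInf (i + (u.length + (h (r + 2)).length) + j)) := by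
      intro j hj
      rw [add_assoc i, ← hocc _ (by omega), List.getElem?_append_right (by omega),
        List.getElem?_append_right (by omega)]
      congr 1
      omega
    have hl := ih i o1
    by_contra! hlt
    have f1 : Nat.fib (2 * (r + 1) + 2) = Nat.fib (2 * r + 2) + Nat.fib (2 * r + 3) :=
      Nat.fib_add_two
    refine no_repetition_fibInf r i (u.length + (h (r + 2)).length) (by omega) (by omega) ?_
    intro j hj
    have := (o1 j (by omega)).symm.trans (o2 j (by omega))
    exact Option.some.inj this

theorem fib_le_of_embeds_zimin (r n : ℕ) (he : Embeds (zimin (r + 1)) (fibPrefix n)) :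
    Nat.fib (2 * r + 2) ≤ n := by
  obtain ⟨h, hne, s, t, hst⟩ := he
  have hlen : s.length + ((zimin (r + 1)).flatMap h).length + t.length = n := by
    have := congrArg List.length hst
    simpa [fibPrefix, add_assoc] using this
  refine (fib_le_length_zimin h hne r s.length fun j hj => ?_).trans (by omega)
  have h1 : (s ++ (zimin (r + 1)).flatMap h ++ t)[s.length + j]? =
      ((zimin (r + 1)).flatMap h)[j]? := by
    rw [List.append_assoc, List.getElem?_append_right (by omega), Nat.add_sub_cancel_left,
      List.getElem?_append_left hj]
  rw [← h1, hst, fibPrefix, List.getElem?_map, List.getElem?_range (by omega)]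
  rfl

/-- The index, shifted by one, of the Fibonacci word substituted for `x_i`. -/
def ziminIndex (i : ℕ) : ℕ := if i ≤ 1 then 1 else 2 * i - 4

theorem flatMap_zimin_fibWordAux (k : ℕ) :
    (zimin (k + 1)).flatMap (fun i => fibWordAux (ziminIndex i)) = fibWordAux (2 * k + 1) := by
  induction k with
  | zero => rfl
  | succ k ih =>
    have e : ziminIndex (k + 1 + 1) = 2 * k := by
      unfold ziminIndex
      split_ifs <;> omega
    rw [zimin, List.flatMap_append, List.flatMap_append, ih, List.flatMap_singleton, e]
    rfl

theorem fibPrefix_prefix {m n : ℕ} (h : m ≤ n) : fibPrefix m <+: fibPrefix n := by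
  obtain ⟨d, rfl⟩ := Nat.exists_eq_add_of_le h
  rw [fibPrefix, fibPrefix, List.range_add, List.map_append]
  exact List.prefix_append _ _

theorem fibWordAux_ne_nil (m : ℕ) : fibWordAux m ≠ [] := by
  apply List.ne_nil_of_length_pos
  rw [length_fibWordAux]
  exact Nat.fib_pos.2 (by omega)

theorem embedsVia_zimin_fibPrefix (k n : ℕ) (h : Nat.fib (2 * k + 2) ≤ n) :
    EmbedsVia (fun i => fibWordAux (ziminIndex i)) (zimin (k + 1)) (fibPrefix n) := by
  refine ⟨fun x => fibWordAux_ne_nil _, ?_⟩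
  rw [flatMap_zimin_fibWordAux]
  have h1 : fibPrefix (Nat.fib (2 * k + 2)) = fibWordAux (2 * k + 1) := by
    have := fibPrefix_length_fibWord (2 * k)
    have e : fibWord ((2 * k : ℕ) : ℤ) = fibWordAux (2 * k + 1) := by
      rw [fibWord]; congr 1
    push_cast at this e
    rw [e, length_fibWordAux] at this
    exact this
  rw [← h1]
  exact (fibPrefix_prefix h).isInfix

theorem isGreatest_zimin_rank (k n : ℕ) (h1 : Nat.fib (2 * k + 2) ≤ n)
    (h2 : n < Nat.fib (2 * k + 4)) :
    IsGreatest {r : ℕ | 1 ≤ r ∧ Embeds (zimin r) (fibPrefix n)} (k + 1) := by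
  refine ⟨⟨by omega, _, embedsVia_zimin_fibPrefix k n h1⟩, ?_⟩
  rintro r ⟨hr, he⟩
  obtain ⟨q, rfl⟩ := Nat.exists_eq_add_of_le' hr
  by_contra! hlt
  have := fib_le_of_embeds_zimin q n he
  have hm : Nat.fib (2 * k + 4) ≤ Nat.fib (2 * q + 2) := Nat.fib_mono (by omega)
  omega

theorem exists_fib_bracket (n : ℕ) (hn : 1 ≤ n) :
    ∃ k, Nat.fib (2 * k + 2) ≤ n ∧ n < Nat.fib (2 * k + 4) := by
  have hex : ∃ m, n < Nat.fib (2 * m + 4) :=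
    ⟨n + 1, lt_of_lt_of_le (by omega) (Nat.le_fib_self (by omega : 5 ≤ 2 * (n + 1) + 4))⟩
  classical
  refine ⟨Nat.find hex, ?_, Nat.find_spec hex⟩
  rcases hq : Nat.find hex with _ | q
  · exact hn
  · have := Nat.find_min hex (m := q) (by omega)
    have e : 2 * (q + 1) + 2 = 2 * q + 4 := by ring
    rw [e]
    omega

theorem two_pow_le_fib (k : ℕ) : 2 ^ k ≤ Nat.fib (2 * k + 2) := by
  induction k with
  | zero => simp
  | succ k ih =>
    have e : Nat.fib (2 * (k + 1) + 2) = Nat.fib (2 * k + 2) + Nat.fib (2 * k + 3) :=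
      Nat.fib_add_two
    have : Nat.fib (2 * k + 2) ≤ Nat.fib (2 * k + 3) := Nat.fib_mono (by omega)
    rw [e, pow_succ]
    omega

/-! The program -/

theorem machineRun_add {N : ℕ} {P : Program} {s t : ℕ} {c c' : Config}
    (h : machineRun N P s c = some c') :
    machineRun N P (s + t) c = machineRun N P t c' := by
  induction s generalizing c with
  | zero =>
    simp only [machineRun, Option.some.injEq] at h
    rw [h, zero_add]
  | succ s ih =>
    rw [Nat.add_right_comm, machineRun]
    rw [machineRun] at h
    rcases hc : machineStep N P c with _ | c''
    · simp [hc] at h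
    · rw [hc] at h
      exact ih h

/-- The first loop runs through the Fibonacci numbers to find the maximal rank (register `4`), the
second loop writes the description of the morphism. -/
def ziminProgram : Program :=
  [.const 1 1, .const 2 1, .add 3 1 1, .const 4 1,
    .jle 3 0 6, .jle 1 1 12, .add 2 2 3, .jle 2 0 9, .jle 1 1 12, .add 3 2 3, .add 4 4 1,
    .jle 1 1 4,
    .write 4, .write 1, .const 5 1,
    .jle 4 5 21, .write 6, .add 6 6 1, .add 6 6 1, .add 5 5 1, .jle 1 1 15,
    .halt]

theorem ziminProgram_search_step (n k : ℕ) (r : ℕ → ℕ) (o : List ℕ)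
    (h0 : r 0 = n) (h1 : r 1 = 1) (h2 : r 2 = Nat.fib (2 * k + 2))
    (h3 : r 3 = Nat.fib (2 * k + 3)) (h4 : r 4 = k + 1)
    (hn : Nat.fib (2 * k + 4) ≤ n) (hk : k < n) :
    ∃ r', machineRun n ziminProgram 6 ⟨4, r, o⟩ = some ⟨4, r', o⟩ ∧ r' 0 = n ∧ r' 1 = 1 ∧
      r' 2 = Nat.fib (2 * (k + 1) + 2) ∧ r' 3 = Nat.fib (2 * (k + 1) + 3) ∧ r' 4 = k + 2 ∧
      r' 6 = r 6 := by
  have e1 : Nat.fib (2 * k + 4) = Nat.fib (2 * k + 2) + Nat.fib (2 * k + 3) := Nat.fib_add_two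
  have e2 : Nat.fib (2 * (k + 1) + 2) = Nat.fib (2 * k + 2) + Nat.fib (2 * k + 3) :=
    Nat.fib_add_two
  have e3 : Nat.fib (2 * (k + 1) + 3) = Nat.fib (2 * k + 3) + Nat.fib (2 * k + 4) :=
    Nat.fib_add_two
  have g1 : Nat.fib (2 * k + 3) ≤ n := by omega
  have g2 : Nat.fib (2 * k + 2) ≤ n := by omega
  have g3 : Nat.fib (2 * k + 2) + Nat.fib (2 * k + 3) ≤ n := by omega
  have g4 : 1 ≤ n := by omega
  have g5 : k + 1 ≤ n := by omega
  refine ⟨_, by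
    simp [machineRun, machineStep, ziminProgram, h0, h1, h2, h3, h4, g1, g2,
      g3, g4, g5]
    rfl, ?_⟩
  simp [h0, h1, e2, e3, e1]
  omega

theorem ziminProgram_search_exit (n k : ℕ) (r : ℕ → ℕ) (o : List ℕ)
    (h0 : r 0 = n) (h1 : r 1 = 1) (h2 : r 2 = Nat.fib (2 * k + 2))
    (h3 : r 3 = Nat.fib (2 * k + 3)) (hk : Nat.fib (2 * k + 2) ≤ n)
    (hn : n < Nat.fib (2 * k + 4)) :
    ∃ t ≤ 4, ∃ r', machineRun n ziminProgram t ⟨4, r, o⟩ = some ⟨12, r', o⟩ ∧ r' 1 = 1 ∧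
      r' 4 = r 4 ∧ r' 6 = r 6 := by
  have e1 : Nat.fib (2 * k + 4) = Nat.fib (2 * k + 2) + Nat.fib (2 * k + 3) := Nat.fib_add_two
  by_cases g1 : Nat.fib (2 * k + 3) ≤ n
  · have g3 : ¬ Nat.fib (2 * k + 2) + Nat.fib (2 * k + 3) ≤ n := by omega
    refine ⟨4, le_rfl, Function.update r 2 (Nat.fib (2 * k + 2) + Nat.fib (2 * k + 3)), ?_⟩
    simp [machineRun, machineStep, ziminProgram, h0, h1, h2, h3, g1, hk, g3]
  · refine ⟨2, by omega, r, ?_⟩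
    simp [machineRun, machineStep, ziminProgram, h0, h1, h3, g1]

theorem ziminProgram_search (n k : ℕ) (hk : Nat.fib (2 * k + 2) ≤ n)
    (hn : n < Nat.fib (2 * k + 4)) (o : List ℕ) (m : ℕ) :
    ∀ (j : ℕ) (r : ℕ → ℕ), j + m = k → r 0 = n → r 1 = 1 → r 2 = Nat.fib (2 * j + 2) →
      r 3 = Nat.fib (2 * j + 3) → r 4 = j + 1 →
      ∃ t ≤ 6 * m + 4, ∃ r', machineRun n ziminProgram t ⟨4, r, o⟩ = some ⟨12, r', o⟩ ∧
        r' 1 = 1 ∧ r' 4 = k + 1 ∧ r' 6 = r 6 := by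
  have hkn : k < n := lt_of_lt_of_le Nat.lt_two_pow_self ((two_pow_le_fib k).trans hk)
  induction m with
  | zero =>
    intro j r hj h0 h1 h2 h3 h4
    obtain rfl : j = k := by omega
    obtain ⟨t, ht, r', hr, a1, a4, a6⟩ := ziminProgram_search_exit n j r o h0 h1 h2 h3 hk hn
    exact ⟨t, by omega, r', hr, a1, by omega, a6⟩
  | succ m ih =>
    intro j r hj h0 h1 h2 h3 h4
    have hle : Nat.fib (2 * j + 4) ≤ n := (Nat.fib_mono (by omega)).trans hk
    obtain ⟨r', hr, a0, a1, a2, a3, a4, a6⟩ :=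
      ziminProgram_search_step n j r o h0 h1 h2 h3 h4 hle (by omega)
    obtain ⟨t, ht, r'', hr', b1, b4, b6⟩ := ih (j + 1) r' (by omega) a0 a1 a2 a3 a4
    exact ⟨6 + t, by omega, r'', (machineRun_add hr).trans hr', b1, b4, b6.trans a6⟩

theorem ziminProgram_output (n k m : ℕ) (hkn : 2 * k ≤ n + 1) :
    ∀ (j : ℕ) (r : ℕ → ℕ) (o : List ℕ), j + m = k → r 1 = 1 → r 4 = k + 1 → r 5 = j + 1 →
      r 6 = 2 * j →
      ∃ r', machineRun n ziminProgram (6 * m + 1) ⟨15, r, o⟩ =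
        some ⟨21, r', o ++ (List.range' j m).map (2 * ·)⟩ := by
  induction m with
  | zero =>
    intro j r o hj h1 h4 h5 h6
    have : k ≤ j := by omega
    exact ⟨r, by simp [machineRun, machineStep, ziminProgram, h4, h5, this]⟩
  | succ m ih =>
    intro j r o hj h1 h4 h5 h6
    have g1 : ¬ k ≤ j := by omega
    have g2 : 2 * j ≤ n := by omega
    have g3 : 2 * j + 1 ≤ n := by omega
    have g4 : 1 ≤ n := by omega
    have g5 : j + 1 ≤ n := by omega
    have hs : machineRun n ziminProgram 6 ⟨15, r, o⟩ =
        some ⟨15, Function.update (Function.update r 6 (2 * j + 2)) 5 (j + 2), o ++ [2 * j]⟩ := by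
      simp [machineRun, machineStep, ziminProgram, h1, h4, h5, h6, g1, g2,
        g3, g4, g5]
    obtain ⟨r', hr⟩ := ih (j + 1)
      (Function.update (Function.update r 6 (2 * j + 2)) 5 (j + 2)) (o ++ [2 * j]) (by omega)
      (by simp [h1]) (by simp [h4])
      (by simp) (by simp; ring)
    refine ⟨r', ?_⟩
    have e : 6 * (m + 1) + 1 = 6 + (6 * m + 1) := by ring
    rw [e, machineRun_add hs, hr]
    simp [List.range'_succ]

theorem ziminProgram_computes (n k : ℕ) (hk : Nat.fib (2 * k + 2) ≤ n)
    (hn : n < Nat.fib (2 * k + 4)) :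
    ∃ t ≤ 12 * k + 12,
      ComputesInTime ziminProgram n t ((k + 1) :: 1 :: (List.range k).map (2 * ·)) := by
  have hpow := (two_pow_le_fib k).trans hk
  have g1 : 1 ≤ n := Nat.one_le_two_pow.trans hpow
  have hkn : 2 * k ≤ n + 1 := by
    have : ∀ k : ℕ, 2 * k ≤ 2 ^ k + 1 := by
      intro k
      induction k with
      | zero => simp
      | succ k ih =>
        rcases k with _ | k
        · norm_num
        · have : 1 ≤ 2 ^ k := Nat.one_le_two_pow
          rw [pow_succ] at ih ⊢
          omega
    exact (this k).trans (by omega)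
  have hinit : ∃ r, machineRun n ziminProgram 4 (initConfig n) = some ⟨4, r, []⟩ ∧ r 0 = n ∧
      r 1 = 1 ∧ r 2 = 1 ∧ r 3 = 2 ∧ r 4 = 1 ∧ r 6 = 0 := by
    refine ⟨_, by
      simp [machineRun, machineStep, ziminProgram, initConfig, g1]
      rfl, ?_⟩
    simp
  obtain ⟨r, hr, a0, a1, a2, a3, a4, a6⟩ := hinit
  obtain ⟨t, ht, r', hr', b1, b4, b6⟩ :=
    ziminProgram_search n k hk hn [] k 0 r (by omega) a0 a1 a2 a3 a4
  have hw : machineRun n ziminProgram 3 ⟨12, r', []⟩ =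
      some ⟨15, Function.update r' 5 1, [k + 1, 1]⟩ := by
    simp [machineRun, machineStep, ziminProgram, b1, b4, g1]
  obtain ⟨r'', hr''⟩ := ziminProgram_output n k k hkn 0 (Function.update r' 5 1) [k + 1, 1]
    (by omega) (by simp [b1]) (by simp [b4])
    (by simp) (by simp [b6, a6])
  refine ⟨4 + (t + (3 + (6 * k + 1))), by omega, ⟨21, r'', [k + 1, 1] ++ (List.range' 0 k).map (2 * ·)⟩,
    ?_, rfl, ?_⟩
  · exact (machineRun_add hr).trans ((machineRun_add hr').trans ((machineRun_add hw).trans hr''))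
  · simp [List.range_eq_range']

theorem describesMorphism_ziminIndex (k : ℕ) :
    DescribesMorphism (1 :: (List.range k).map (2 * ·)) (k + 1)
      (fun i => fibWordAux (ziminIndex i)) := by
  refine ⟨by simp, ?_⟩
  rintro (_ | i) hi
  · rfl
  · simp only [List.getElem_cons_succ, List.getElem_map, List.getElem_range, fibWord, ziminIndex]
    congr 1
    split_ifs <;> omega

theorem mainTheorem5 :
    ∃ (P : Program) (T : ℕ → ℕ),
      Asymptotics.IsBigO Filter.atTop (fun n : ℕ => (T n : ℝ)) (fun n : ℕ => Real.log (n : ℝ)) ∧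
      ∀ n : ℕ, 1 ≤ n →
        ∃ (k : ℕ) (h : ℕ → List Letter) (code : List ℕ),
          ComputesInTime P n (T n) (k :: code) ∧
          IsGreatest {r : ℕ | 1 ≤ r ∧ Embeds (zimin r) (fibPrefix n)} k ∧
          EmbedsVia h (zimin k) (fibPrefix n) ∧
          DescribesMorphism code k h ∧
          h 1 = fibWord 0 ∧
          ∀ i : ℕ, 2 ≤ i → i ≤ k → h i = fibWord (2 * (i : ℤ) - 5) := by
  have hall : ∀ n : ℕ, ∃ t k : ℕ, 1 ≤ n → Nat.fib (2 * k + 2) ≤ n ∧ n < Nat.fib (2 * k + 4) ∧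
      t ≤ 12 * k + 12 ∧
      ComputesInTime ziminProgram n t ((k + 1) :: 1 :: (List.range k).map (2 * ·)) := by
    intro n
    by_cases hn : 1 ≤ n
    · obtain ⟨k, h1, h2⟩ := exists_fib_bracket n hn
      obtain ⟨t, ht, hc⟩ := ziminProgram_computes n k h1 h2
      exact ⟨t, k, fun _ => ⟨h1, h2, ht, hc⟩⟩
    · exact ⟨0, 0, fun h => absurd h hn⟩
  choose T K hTK using hall
  refine ⟨ziminProgram, T, ?_, ?_⟩
  · refine Asymptotics.IsBigO.of_bound (24 / Real.log 2) ?_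
    filter_upwards [Filter.eventually_ge_atTop 2] with n hn
    obtain ⟨h1, -, ht, -⟩ := hTK n (by omega)
    have hlog2 : 0 < Real.log 2 := Real.log_pos one_lt_two
    have hlogn : Real.log 2 ≤ Real.log n := Real.log_le_log two_pos (by exact_mod_cast hn)
    have hK : (K n : ℝ) * Real.log 2 ≤ Real.log n := by
      rw [← Real.log_pow]
      refine Real.log_le_log (by positivity) ?_
      exact_mod_cast (two_pow_le_fib (K n)).trans h1
    have hT : (T n : ℝ) ≤ 12 * K n + 12 := by exact_mod_cast ht
    rw [Real.norm_of_nonneg (Nat.cast_nonneg _), Real.norm_of_nonneg (hlog2.le.trans hlogn),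
      div_mul_eq_mul_div, le_div_iff₀ hlog2]
    nlinarith
  · intro n hn
    obtain ⟨h1, h2, -, hc⟩ := hTK n hn
    refine ⟨K n + 1, _, _, hc, isGreatest_zimin_rank _ _ h1 h2, embedsVia_zimin_fibPrefix _ _ h1,
      describesMorphism_ziminIndex _, rfl, ?_⟩
    intro i hi _
    simp only [fibWord, ziminIndex]
    congr 1
    split_ifs <;> omega
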